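/- Let $M$ be a von Neumann algebra (on a complex Hilbert space) with a normal faithful normalized trace $\tau$, let $L_p(M)=L_p(M,\tau)$ be the associated noncommutative $L_p$-spaces ($L_\infty(M)=M$ with the operator norm, and $\|x\|_p=\tau(|x|^p)^{1/p}$, $|x|=(x^*x)^{1/2}$, for $p<\infty$), and let $(M_n)_{n\ge 1}$ be an increasing sequence of von Neumann subalgebras of $M$ whose union is weak-* dense in $M$. Let $E_n$ be the trace preserving conditional expectation onto $M_n$, extended to the spaces $L_p(M)$, and put $E_0=0$ and $da_n=E_n(a)-E_{n-1}(a)$ for $a\in L_2(M)$ and $n\ge 1$. Write $\|f\|_\infty=\infty$ if $f\in L_1(M)$ is not in $M$. For $a\in L_2(M)$ set, with values in $[0,\infty]$, $$\|a\|_{BMO^c}=\Big(\sup_{n\ge1}\|E_n(|a-E_{n-1}(a)|^2)\|_\infty\Big)^{1/2},\qquad \|a\|_{BMO^r}=\|a^*\|_{BMO^c},\qquad \|a\|_{BMO}=\max(\|a\|_{BMO^c},\|a\|_{BMO^r}),$$ $$\|a\|_{bmo^c}=\max\Big(\|E_1(a)\|_\infty,\ \Big(\sup_{n\ge1}\|E_n(|a-E_n(a)|^2)\|_\infty\Big)^{1/2}\Big),\qquad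 \|a\|_{bmo^r}=\|a^*\|_{bmo^c},$$ $$\|a\|_{bmo^d}=\sup_{n\ge1}\|da_n\|_\infty,\qquad \|a\|_{bmo}=\max(\|a\|_{bmo^c},\|a\|_{bmo^r},\|a\|_{bmo^d}).$$ Let $$BMO^c=\{a\in L_2(M):\sup_{n\ge1}\|E_n(|a-E_{n-1}(a)|^2)\|_\infty<\infty\},\qquad bmo^c=\{a\in L_2(M):\sup_{n\ge1}\|E_n(|a-E_n(a)|^2)\|_\infty<\infty\},$$ $BMO^r=\{a\in L_2(M):a^*\in BMO^c\}$, $bmo^r=\{a\in L_2(M):a^*\in bmo^c\}$, and $BMO=BMO^c\cap BMO^r$. Let $bmo^d$ be the space of all martingale difference sequences $(d_n)_{n\ge1}$ in $M$ with $\sup_n\|d_n\|_\infty<\infty$; an element $a$ of $L_2(M)$ is identified with its martingale, so that $a\in bmo^d$ means $(da_n)_{n\ge1}\in bmo^d$. Let $bmo=bmo^c\cap bmo^r\cap bmo^d$. Then $$BMO^c=bmo^c\cap bmo^d,\qquad BMO^r=bmo^r\cap bmo^d,\qquad BMO=bmo.$$ More precisely, for every $a\in L_2(M)$, $$\max(\|a\|_{bmo^c},\|a\|_{bmo^d})\le\|a\|_{BMO^c}\le\sqrt2\,\max(\|a\|_{bmo^c},\|a\|_{bmo^d}),$$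 $$\max(\|a\|_{bmo^r},\|a\|_{bmo^d})\le\|a\|_{BMO^r}\le\sqrt2\,\max(\|a\|_{bmo^r},\|a\|_{bmo^d}),$$ $$\|a\|_{bmo}\le\|a\|_{BMO}\le\sqrt2\,\|a\|_{bmo}.$$ -/

import Mathlib

open scoped ComplexOrder InnerProductSpace ENNReal
open UniformSpace

/-!
Noncommutative martingales over a finite von Neumann algebra: normal faithful normalized traces,
the spaces `L₁(M)` and `L₂(M)`, filtrations, conditional expectations, and the spaces
`BMO^c, BMO^r, BMO` and `bmo^c, bmo^r, bmo^d, bmo`.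
-/

namespace NCMart

/-! ### Von Neumann algebras and traces -/

section Basic

variable {H : Type*} [NormedAddCommGroup H] [InnerProductSpace ℂ H] [CompleteSpace H]

instance : SMulMemClass (VonNeumannAlgebra H) ℂ (H →L[ℂ] H) where
  smul_mem {s} c _ hx := s.toStarSubalgebra.smul_mem hx c

/-- The ultraweak (σ-weak) topology of `B(H)`, i.e. its weak-* topology as the dual of the trace
class operators: the coarsest topology for which all functionals `x ↦ ∑ᵢ ⟨ξᵢ, x ηᵢ⟩`, with
`∑ ‖ξᵢ‖² < ∞` and `∑ ‖ηᵢ‖² < ∞`, are continuous. It induces on each von Neumann algebra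
`M ⊆ B(H)` the weak-* topology of `M`. -/
noncomputable abbrev ultraweakTopology (H : Type*) [NormedAddCommGroup H] [InnerProductSpace ℂ H]
    [CompleteSpace H] : TopologicalSpace (H →L[ℂ] H) :=
  ⨅ (ξ : lp (fun _ : ℕ => H) 2) (η : lp (fun _ : ℕ => H) 2),
    TopologicalSpace.induced (fun x : H →L[ℂ] H => ∑' i : ℕ, ⟪ξ i, x (η i)⟫_ℂ) inferInstance

/-- The weak-* topology of a von Neumann algebra. -/
noncomputable abbrev weakStar (M : VonNeumannAlgebra H) : TopologicalSpace M :=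
  TopologicalSpace.induced (fun x : M => (x : H →L[ℂ] H)) (ultraweakTopology H)

/-- A normal faithful normalized trace on a von Neumann algebra. Positivity refers to the usual
order of operators on `H`. -/
structure NormalTrace (M : VonNeumannAlgebra H) where
  toLinearMap : M →ₗ[ℂ] ℂ
  nonneg : ∀ x : M, 0 ≤ (x : H →L[ℂ] H) → 0 ≤ toLinearMap x
  tracial : ∀ x y : M, toLinearMap (x * y) = toLinearMap (y * x)
  normalized : toLinearMap 1 = 1
  faithful : ∀ x : M, 0 ≤ (x : H →L[ℂ] H) → toLinearMap x = 0 → x = 0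
  normal : @Continuous M ℂ (weakStar M) inferInstance toLinearMap

noncomputable instance (M : VonNeumannAlgebra H) : CoeFun (NormalTrace M) (fun _ => M → ℂ) where
  coe τ := τ.toLinearMap

/-- The inclusion of a von Neumann subalgebra. -/
noncomputable def incl {N M : VonNeumannAlgebra H} (h : N ≤ M) : N →ₗᵢ[ℂ] M where
  toFun x := ⟨x, h x.2⟩
  map_add' _ _ := rfl
  map_smul' _ _ := rfl
  norm_map' _ := rfl

/-- The restriction of the trace to a von Neumann subalgebra. -/
noncomputable def NormalTrace.restrict {N M : VonNeumannAlgebra H} (τ : NormalTrace M)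
    (h : N ≤ M) : NormalTrace N where
  toLinearMap := τ.toLinearMap ∘ₗ (incl h).toLinearMap
  nonneg x hx := τ.nonneg _ hx
  tracial x y := τ.tracial (incl h x) (incl h y)
  normalized := τ.normalized
  faithful x hx hx' := by
    have h0 := τ.faithful (incl h x) hx hx'
    exact (incl h).injective (h0.trans (map_zero _).symm)
  normal := by
    have h1 : @Continuous N M (weakStar N) (weakStar M) (fun x : N => incl h x) :=
      continuous_induced_rng.2 (@continuous_induced_dom _ _ _ (ultraweakTopology H))
    exact @Continuous.comp _ _ _ (weakStar N) (weakStar M) _ _ _ τ.normal h1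

end Basic

/-! ### The space `L₂(M)` -/

section L2

variable {H : Type*} [NormedAddCommGroup H] [InnerProductSpace ℂ H] [CompleteSpace H]
  {M : VonNeumannAlgebra H}

/-- `M` with the norm `‖x‖₂ = τ(|x|²)^{1/2} = τ(x* x)^{1/2}`. -/
def PreL2 (_τ : NormalTrace M) : Type _ := M

variable (τ : NormalTrace M)

instance : AddCommGroup (PreL2 τ) := inferInstanceAs (AddCommGroup M)
noncomputable instance : Module ℂ (PreL2 τ) := inferInstanceAs (Module ℂ M)

noncomputable def toPre : M ≃ₗ[ℂ] PreL2 τ := LinearEquiv.refl ℂ _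

theorem star_mul_self_nonneg' (x : M) : 0 ≤ ((star x * x : M) : H →L[ℂ] H) :=
  star_mul_self_nonneg (x : H →L[ℂ] H)

theorem trace_mono {x y : M} (h : (x : H →L[ℂ] H) ≤ y) : τ x ≤ τ y := by
  have h1 : 0 ≤ ((y - x : M) : H →L[ℂ] H) := sub_nonneg.2 h
  have h2 := τ.nonneg _ h1
  rwa [map_sub, sub_nonneg] at h2

theorem trace_star (x : M) : τ (star x) = star (τ x) := by
  have key : ∀ y : M, star (τ (star y * y)) = τ (star y * y) := fun y =>
    (τ.nonneg _ (star_mul_self_nonneg' y)).star_eq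
  have h1 := key (x + 1)
  have h2 := key (x + Complex.I • 1)
  have hx := key x
  have h3 : star (τ (1 : M)) = τ 1 := by rw [τ.normalized]; simp
  simp only [star_add, star_one, add_mul, mul_add, one_mul, mul_one, map_add, star_smul,
    smul_mul_assoc, mul_smul_comm, map_smul, hx, h3] at h1 h2
  simp only [smul_eq_mul, Complex.star_def, Complex.conj_I, map_neg, neg_mul] at *
  apply Complex.ext
  · have := congrArg Complex.im h2
    simp at this
    simp
    linarith
  · have := congrArg Complex.im h1
    simp at this
    simp
    linarith

/-- The inner product `⟨x, y⟩ = τ(x* y)` on `M`. -/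
noncomputable abbrev preCore : InnerProductSpace.Core ℂ (PreL2 τ) where
  inner x y := τ (star ((toPre τ).symm x) * (toPre τ).symm y)
  conj_inner_symm x y := by
    rw [← Complex.star_def, ← trace_star]; simp
  re_inner_nonneg x := (Complex.nonneg_iff.1 (τ.nonneg _ (star_mul_self_nonneg' _))).1
  add_left x y z := by simp [add_mul]
  smul_left x y r := by simp
  definite x hx := by
    have h1 := τ.faithful _ (star_mul_self_nonneg' _) hx
    have h2 : star (((toPre τ).symm x : M) : H →L[ℂ] H) * ((toPre τ).symm x : M) = 0 :=
      congrArg Subtype.val h1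
    have h3 := (CStarRing.star_mul_self_eq_zero_iff _).1 h2
    exact (toPre τ).symm.injective (Subtype.ext h3)

noncomputable instance : NormedAddCommGroup (PreL2 τ) :=
  InnerProductSpace.Core.toNormedAddCommGroup (cd := preCore τ)
noncomputable instance : InnerProductSpace ℂ (PreL2 τ) :=
  InnerProductSpace.ofCore (preCore τ).toCore

/-- The Hilbert space `L₂(M) = L₂(M, τ)`: the completion of `M` for the norm
`‖x‖₂ = τ(|x|²)^{1/2}`. -/
abbrev L2 : Type _ := Completion (PreL2 τ)

theorem inner_toPre (x y : M) : ⟪toPre τ x, toPre τ y⟫_ℂ = τ (star x * y) := rfl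

theorem norm_toPre_sq (x : M) : ((‖toPre τ x‖ ^ 2 : ℝ) : ℂ) = τ (star x * x) := by
  rw [← inner_toPre, inner_self_eq_norm_sq_to_K]; simp

theorem norm_toPre_star (x : M) : ‖toPre τ (star x)‖ = ‖toPre τ x‖ := by
  have h : ((‖toPre τ (star x)‖ ^ 2 : ℝ) : ℂ) = ((‖toPre τ x‖ ^ 2 : ℝ) : ℂ) := by
    rw [norm_toPre_sq, norm_toPre_sq, star_star, τ.tracial]
  have h' := Complex.ofReal_injective h
  exact (sq_eq_sq₀ (norm_nonneg _) (norm_nonneg _)).1 h'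

theorem norm_toPre_mul_left (x y : M) : ‖toPre τ (x * y)‖ ≤ ‖x‖ * ‖toPre τ y‖ := by
  rw [← sq_le_sq₀ (by positivity) (by positivity), mul_pow]
  have h1 : ((star (x * y) * (x * y) : M) : H →L[ℂ] H)
      ≤ ((((‖x‖ ^ 2 : ℝ) : ℂ) • (star y * y) : M) : H →L[ℂ] H) := by
    have h2 := CStarAlgebra.star_left_conjugate_le_norm_smul (a := (y : H →L[ℂ] H))
      (b := star (x : H →L[ℂ] H) * x) (IsSelfAdjoint.star_mul_self _)
    rw [CStarRing.norm_star_mul_self, ← sq] at h2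
    have h4 : ((((‖x‖ ^ 2 : ℝ) : ℂ) • (star y * y) : M) : H →L[ℂ] H)
        = ‖(x : H →L[ℂ] H)‖ ^ 2 • (star (y : H →L[ℂ] H) * (y : H →L[ℂ] H)) :=
      Complex.coe_smul (‖x‖ ^ 2) (star (y : H →L[ℂ] H) * (y : H →L[ℂ] H))
    rw [h4]
    convert h2 using 1
    change star ((x : H →L[ℂ] H) * y) * ((x : H →L[ℂ] H) * y) = _
    rw [star_mul]; simp only [mul_assoc]
  have h3 := trace_mono τ h1
  rw [map_smul, ← norm_toPre_sq, ← norm_toPre_sq, smul_eq_mul, ← Complex.ofReal_mul] at h3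
  exact_mod_cast h3

theorem norm_toPre_mul_right (y x : M) : ‖toPre τ (y * x)‖ ≤ ‖x‖ * ‖toPre τ y‖ := by
  rw [← norm_toPre_star, star_mul]
  refine (norm_toPre_mul_left τ _ _).trans ?_
  rw [norm_toPre_star]
  exact le_of_eq (congrArg (· * _) (norm_star (x : H →L[ℂ] H)))

theorem norm_toPre_le (x : M) : ‖toPre τ x‖ ≤ ‖x‖ := by
  have h1 : ((‖toPre τ 1‖ ^ 2 : ℝ) : ℂ) = 1 := by
    rw [norm_toPre_sq, star_one, one_mul, τ.normalized]
  have h2 : ‖toPre τ 1‖ ^ 2 = 1 := by exact_mod_cast h1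
  have h3 : ‖toPre τ 1‖ = 1 := by
    rw [← Real.sqrt_sq (norm_nonneg (toPre τ 1)), h2, Real.sqrt_one]
  simpa [h3] using norm_toPre_mul_left τ x 1

/-- The inclusion `M = L_∞(M) ⊆ L₂(M)`. -/
noncomputable def toL2 : M →L[ℂ] L2 τ :=
  Completion.toComplL (𝕜 := ℂ) (E := PreL2 τ) ∘L
    (toPre τ).toLinearMap.mkContinuous 1 (fun x => by simpa using norm_toPre_le τ x)

@[simp] theorem toL2_apply (x : M) : toL2 τ x = ((toPre τ x : PreL2 τ) : L2 τ) := rfl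

/-- The adjoint `a ↦ a*` of `L₂(M)`: the continuous extension of the adjoint of `M`. -/
noncomputable def adj : L2 τ →L⋆[ℂ] L2 τ :=
  ContinuousLinearMap.completion
    (LinearMap.mkContinuous
      { toFun := fun x : PreL2 τ => toPre τ (star ((toPre τ).symm x))
        map_add' := fun x y => by simp
        map_smul' := fun c x => by simp } 1
      (fun x => by simpa using (norm_toPre_star τ ((toPre τ).symm x)).le))

@[simp] theorem adj_coe (x : M) : adj τ ((toPre τ x : PreL2 τ) : L2 τ)
    = ((toPre τ (star x) : PreL2 τ) : L2 τ) := by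
  simp [adj]

/-- Right multiplication `y ↦ y x` on `(M, ‖·‖₂)` by an element `x` of `M`. -/
noncomputable def preRMul (x : M) : PreL2 τ →L[ℂ] PreL2 τ :=
  LinearMap.mkContinuous
    { toFun := fun y : PreL2 τ => toPre τ ((toPre τ).symm y * x)
      map_add' := fun y z => by simp [add_mul]
      map_smul' := fun c y => by simp } ‖x‖
    (fun y => norm_toPre_mul_right τ ((toPre τ).symm y) x)

@[simp] theorem preRMul_apply (x y : M) : preRMul τ x (toPre τ y) = toPre τ (y * x) := rfl

theorem preRMul_add (x y : M) : (preRMul τ (x + y)).completion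
    = (preRMul τ x).completion + (preRMul τ y).completion := by
  ext b
  induction b using Completion.induction_on with
  | hp => exact isClosed_eq (map_continuous _) (map_continuous _)
  | ih b =>
    rw [add_apply]
    simp only [ContinuousLinearMap.completion_apply_coe]
    rw [← Completion.coe_add]
    exact congrArg _ (mul_add ((toPre τ).symm b) x y)

theorem preRMul_smul (c : ℂ) (x : M) : (preRMul τ (c • x)).completion
    = c • (preRMul τ x).completion := by
  ext b
  induction b using Completion.induction_on with
  | hp => exact isClosed_eq (map_continuous _) (map_continuous _)
  | ih b =>
    rw [smul_apply]
    simp only [ContinuousLinearMap.completion_apply_coe]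
    rw [← Completion.coe_smul]
    exact congrArg _ (mul_smul_comm c ((toPre τ).symm b) x)

theorem norm_preRMul_le (x : M) : ‖(preRMul τ x).completion‖ ≤ ‖x‖ := by
  refine ContinuousLinearMap.opNorm_le_bound _ (norm_nonneg _) fun b => ?_
  induction b using Completion.induction_on with
  | hp => exact isClosed_le (map_continuous _).norm (continuous_const.mul continuous_norm)
  | ih b =>
    rw [ContinuousLinearMap.completion_apply_coe, Completion.norm_coe, Completion.norm_coe]
    exact norm_toPre_mul_right τ ((toPre τ).symm b) x

/-- The product `b x ∈ L₂(M)` of `b ∈ L₂(M)` and `x ∈ M`, as a map `x ↦ (b ↦ b x)`: the continuous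
extension of the product of `M`. -/
noncomputable def rmul : M →L[ℂ] L2 τ →L[ℂ] L2 τ :=
  LinearMap.mkContinuous
    { toFun := fun x => (preRMul τ x).completion
      map_add' := preRMul_add τ
      map_smul' := preRMul_smul τ } 1
    (fun x => (norm_preRMul_le τ x).trans (one_mul _).ge)

@[simp] theorem rmul_coe (x y : M) : rmul τ x ((toPre τ y : PreL2 τ) : L2 τ)
    = ((toPre τ (y * x) : PreL2 τ) : L2 τ) := by
  simp [rmul]

/-- The closed subspace `L₂(N)` of `L₂(M)`, for a von Neumann subalgebra `N` of `M`. -/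
noncomputable def subL2 {N : VonNeumannAlgebra H} (h : N ≤ M) : Submodule ℂ (L2 τ) :=
  (LinearMap.range ((toL2 τ).toLinearMap ∘ₗ (incl h).toLinearMap)).topologicalClosure

instance {N : VonNeumannAlgebra H} (h : N ≤ M) : CompleteSpace (subL2 τ h) :=
  (Submodule.isClosed_topologicalClosure _).completeSpace_coe

/-- The trace preserving conditional expectation `L₂(M) → L₂(N)`: the orthogonal projection of
`L₂(M)` onto `L₂(N)`. -/
noncomputable def condExpL2 {N : VonNeumannAlgebra H} (h : N ≤ M) : L2 τ →L[ℂ] L2 τ :=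
  (subL2 τ h).starProjection

end L2

/-! ### The space `L₁(M)` -/

section L1

variable {H : Type*} [NormedAddCommGroup H] [InnerProductSpace ℂ H] [CompleteSpace H]
  {M : VonNeumannAlgebra H} (τ : NormalTrace M)

/-- The functional `x ↦ τ(a* b x)` on `M`, for `a, b ∈ L₂(M)`. -/
noncomputable def prodFun (a b : L2 τ) : StrongDual ℂ M :=
  innerSL ℂ a ∘L (rmul τ).flip b

theorem prodFun_apply (a b : L2 τ) (x : M) : prodFun τ a b x = ⟪a, rmul τ x b⟫_ℂ := rfl

theorem prodFun_coe (y z x : M) :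
    prodFun τ (toL2 τ y) (toL2 τ z) x = τ (star y * (z * x)) := by
  rw [prodFun_apply, toL2_apply, toL2_apply, rmul_coe, Completion.inner_coe, inner_toPre]

/-- The functional `x ↦ τ(y x)` on `M`, for `y ∈ M`. -/
noncomputable def traceFun : M →ₗ[ℂ] StrongDual ℂ M where
  toFun y := prodFun τ (toL2 τ (star y)) (toL2 τ 1)
  map_add' y z := by
    ext x
    rw [add_apply, prodFun_coe, prodFun_coe, prodFun_coe]
    simp [add_mul]
  map_smul' c y := by
    ext x
    rw [smul_apply, prodFun_coe, prodFun_coe]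
    simp

@[simp] theorem traceFun_apply (y x : M) : traceFun τ y x = τ (y * x) := by
  rw [traceFun, LinearMap.coe_mk, AddHom.coe_mk, prodFun_coe, star_star, one_mul]

/-- The space `L₁(M)`, realized in the usual way inside the dual of `M` (as the predual of `M`):
an element `y` of `M` is identified with the functional `τ(y ·)`, whose norm is
`‖y‖₁ = τ(|y|)`, and `L₁(M)` is the completion of `M` for this norm. -/
noncomputable def L1 : Submodule ℂ (StrongDual ℂ M) :=
  (LinearMap.range (traceFun τ)).topologicalClosure

/-- The inclusion `M = L_∞(M) ⊆ L₁(M)`. -/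
noncomputable def toL1 : M →ₗ[ℂ] L1 τ :=
  (traceFun τ).codRestrict (L1 τ)
    (fun y => Submodule.le_topologicalClosure _ (LinearMap.mem_range_self _ y))

theorem prodFun_mem (a b : L2 τ) : prodFun τ a b ∈ L1 τ := by
  induction a, b using Completion.induction_on₂ with
  | hp =>
    refine (Submodule.isClosed_topologicalClosure _).preimage ?_
    change Continuous fun p : L2 τ × L2 τ => innerSL ℂ p.1 ∘L (rmul τ).flip p.2
    exact ((innerSL ℂ).continuous.comp continuous_fst).clm_comp
      ((rmul τ).flip.continuous.comp continuous_snd)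
  | ih a b =>
    refine Submodule.le_topologicalClosure _ ⟨star ((toPre τ).symm a) * (toPre τ).symm b, ?_⟩
    ext x
    rw [traceFun_apply, mul_assoc]
    exact (prodFun_coe τ _ _ x).symm

/-- The element `|a|² = a* a` of `L₁(M)`, for `a ∈ L₂(M)`. -/
noncomputable def absSq (a : L2 τ) : L1 τ := ⟨prodFun τ a a, prodFun_mem τ a a⟩

/-- The functionals `x ↦ ⟨b, x⟩` on `N`, with `b ∈ L₂(N)`, belong to `L₁(N)`. -/
theorem subL2_fun_mem {N : VonNeumannAlgebra H} (h : N ≤ M) {b : L2 τ} (hb : b ∈ subL2 τ h) :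
    innerSL ℂ b ∘L (toL2 τ ∘L (incl h).toContinuousLinearMap) ∈ L1 (τ.restrict h) := by
  have hcl : IsClosed {b : L2 τ |
      innerSL ℂ b ∘L (toL2 τ ∘L (incl h).toContinuousLinearMap) ∈ L1 (τ.restrict h)} :=
    (Submodule.isClosed_topologicalClosure _).preimage
      ((innerSL ℂ).continuous.clm_comp continuous_const)
  refine closure_minimal ?_ hcl hb
  rintro _ ⟨y, rfl⟩
  refine Submodule.le_topologicalClosure _ ⟨star y, ?_⟩
  ext x
  rw [traceFun_apply]
  exact (Completion.inner_coe (toPre τ (incl h y)) (toPre τ (incl h x))).symm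

theorem restrict_mem {N : VonNeumannAlgebra H} (h : N ≤ M) {f : StrongDual ℂ M} (hf : f ∈ L1 τ) :
    f ∘L (incl h).toContinuousLinearMap ∈ L1 (τ.restrict h) := by
  have hcl : IsClosed {f : StrongDual ℂ M |
      f ∘L (incl h).toContinuousLinearMap ∈ L1 (τ.restrict h)} :=
    (Submodule.isClosed_topologicalClosure _).preimage
      (continuous_id.clm_comp continuous_const)
  refine closure_minimal ?_ hcl hf
  rintro _ ⟨y, rfl⟩
  have h1 := subL2_fun_mem τ h ((subL2 τ h).starProjection_apply_mem (toL2 τ (star y)))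
  suffices h2 : traceFun τ y ∘L (incl h).toContinuousLinearMap
      = innerSL ℂ ((subL2 τ h).starProjection (toL2 τ (star y)))
        ∘L (toL2 τ ∘L (incl h).toContinuousLinearMap) from by
    change _ ∈ L1 (τ.restrict h)
    rw [h2]; exact h1
  ext x
  have hx : toL2 τ (incl h x) ∈ subL2 τ h :=
    Submodule.le_topologicalClosure _ ⟨x, rfl⟩
  change traceFun τ y (incl h x)
    = ⟪(subL2 τ h).starProjection (toL2 τ (star y)), toL2 τ (incl h x)⟫_ℂ
  rw [Submodule.inner_starProjection_left_eq_right,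
    Submodule.starProjection_eq_self_iff.2 hx, toL2_apply, toL2_apply, Completion.inner_coe,
    inner_toPre, traceFun_apply, star_star]

/-- The trace preserving conditional expectation `E : L₁(M) → L₁(N)`, for a von Neumann subalgebra
`N` of `M`. It is determined by `τ(E(f) x) = τ(f x)` for all `x ∈ N`; as elements of `L₁` are
realized as functionals, it is the restriction of functionals from `M` to `N`. -/
noncomputable def condExpL1 {N : VonNeumannAlgebra H} (h : N ≤ M) :
    L1 τ →ₗ[ℂ] L1 (τ.restrict h) where
  toFun f := ⟨(f : StrongDual ℂ M) ∘L (incl h).toContinuousLinearMap, restrict_mem τ h f.2⟩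
  map_add' _ _ := rfl
  map_smul' _ _ := rfl

/-- The norm `‖f‖_∞ ∈ [0, ∞]` of an element `f` of `L₁(M)`: the operator norm of `f` if `f ∈ M`, and
`∞` otherwise. -/
noncomputable def linftyNormL1 (f : L1 τ) : ℝ≥0∞ := ⨅ (y : M) (_ : toL1 τ y = f), ‖y‖ₑ

/-- The norm `‖a‖_∞ ∈ [0, ∞]` of an element `a` of `L₂(M)`: the operator norm of `a` if `a ∈ M`, and
`∞` otherwise. -/
noncomputable def linftyNormL2 (a : L2 τ) : ℝ≥0∞ := ⨅ (y : M) (_ : toL2 τ y = a), ‖y‖ₑ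

end L1

/-! ### Martingales and the spaces `BMO` and `bmo` -/

section Martingale

variable {H : Type*} [NormedAddCommGroup H] [InnerProductSpace ℂ H] [CompleteSpace H]
  {M : VonNeumannAlgebra H}

/-- A filtration `(M_n)_{n ≥ 1}` of `M`: an increasing sequence of von Neumann subalgebras of `M`
whose union is weak-* dense in `M`. The algebra `M_{n+1}` is `alg n`. -/
structure VNFiltration (M : VonNeumannAlgebra H) where
  alg : ℕ → VonNeumannAlgebra H
  mono : Monotone alg
  le : ∀ n, alg n ≤ M
  dense : ∀ x : M, x ∈ @closure M (weakStar M) {y : M | ∃ n, (y : H →L[ℂ] H) ∈ alg n}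

variable (τ : NormalTrace M) (F : VNFiltration M)

/-- The conditional expectations `E_n` on `L₂(M)` with respect to `M_n`, `n ≥ 1`, and `E_0 = 0`. -/
noncomputable def E : ℕ → L2 τ →L[ℂ] L2 τ
  | 0 => 0
  | n + 1 => condExpL2 τ (F.le n)

/-- The martingale differences `da_n = E_n(a) - E_{n-1}(a)`, `n ≥ 1`, of `a ∈ L₂(M)`;
`diff τ F a n` is `da_{n+1}`. -/
noncomputable def diff (a : L2 τ) (n : ℕ) : L2 τ := E τ F (n + 1) a - E τ F n a

/-- `‖E_n(|b|²)‖_∞ ∈ [0, ∞]` for `b ∈ L₂(M)`, at the index `n + 1` in place of `n`. -/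
noncomputable def condSqNorm (n : ℕ) (b : L2 τ) : ℝ≥0∞ :=
  linftyNormL1 (τ.restrict (F.le n)) (condExpL1 τ (F.le n) (absSq τ b))

/-- `sup_{n ≥ 1} ‖E_n(|a - E_{n-1}(a)|²)‖_∞`. -/
noncomputable def supBMO (a : L2 τ) : ℝ≥0∞ := ⨆ n : ℕ, condSqNorm τ F n (a - E τ F n a)

/-- `sup_{n ≥ 1} ‖E_n(|a - E_n(a)|²)‖_∞`. -/
noncomputable def supbmo (a : L2 τ) : ℝ≥0∞ := ⨆ n : ℕ, condSqNorm τ F n (a - E τ F (n + 1) a)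

/-- The space `BMO^c(M)`. -/
def BMOc : Set (L2 τ) := {a | supBMO τ F a < ∞}

/-- The norm of `BMO^c(M)` (with value `∞` outside `BMO^c(M)`). -/
noncomputable def normBMOc (a : L2 τ) : ℝ≥0∞ := supBMO τ F a ^ (1 / 2 : ℝ)

/-- The space `BMO^r(M)`. -/
def BMOr : Set (L2 τ) := {a | adj τ a ∈ BMOc τ F}

/-- The norm of `BMO^r(M)`. -/
noncomputable def normBMOr (a : L2 τ) : ℝ≥0∞ := normBMOc τ F (adj τ a)

/-- The space `BMO(M)`. -/
def BMO : Set (L2 τ) := BMOc τ F ∩ BMOr τ F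

/-- The norm of `BMO(M)`. -/
noncomputable def normBMO (a : L2 τ) : ℝ≥0∞ := max (normBMOc τ F a) (normBMOr τ F a)

/-- The space `bmo^c(M)`. -/
def bmoc : Set (L2 τ) := {a | supbmo τ F a < ∞}

/-- The norm of `bmo^c(M)`. -/
noncomputable def normbmoc (a : L2 τ) : ℝ≥0∞ :=
  max (linftyNormL2 τ (E τ F 1 a)) (supbmo τ F a ^ (1 / 2 : ℝ))

/-- The space `bmo^r(M)`. -/
def bmor : Set (L2 τ) := {a | adj τ a ∈ bmoc τ F}

/-- The norm of `bmo^r(M)`. -/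
noncomputable def normbmor (a : L2 τ) : ℝ≥0∞ := normbmoc τ F (adj τ a)

/-- A martingale `(x_n)_{n ≥ 1}` in `L₂(M)`: `E_n(x_{n+1}) = x_n` for all `n ≥ 1`. For `n = 0` the
condition is the convention `x_0 = 0`. -/
def IsMartingale (x : ℕ → L2 τ) : Prop := ∀ n, E τ F n (x (n + 1)) = x n

/-- The space `bmo^d(M)` of all bounded sequences `(d_n)_{n ≥ 1}` in `M` (elements of
`ℓ_∞(L_∞(M))`) which are martingale difference sequences; `d_{n+1}` is `d n`. -/
def bmodSeq : Set (ℕ → M) :=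
  {d | (⨆ n, ‖d n‖ₑ) < ∞ ∧
    ∃ x : ℕ → L2 τ, IsMartingale τ F x ∧ ∀ n, toL2 τ (d n) = x (n + 1) - x n}

/-- The elements of `L₂(M)` which belong to `bmo^d(M)`, when `a ∈ L₂(M)` is identified with its
martingale difference sequence `(da_n)`. -/
def bmod : Set (L2 τ) := {a | ∃ d ∈ bmodSeq τ F, ∀ n, toL2 τ (d n) = diff τ F a n}

/-- The norm of `bmo^d(M)`: `‖a‖ = sup_{n ≥ 1} ‖da_n‖_∞`. -/
noncomputable def normbmod (a : L2 τ) : ℝ≥0∞ := ⨆ n : ℕ, linftyNormL2 τ (diff τ F a n)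

/-- The space `bmo(M)`. -/
def bmo : Set (L2 τ) := bmoc τ F ∩ bmor τ F ∩ bmod τ F

/-- The norm of `bmo(M)`. -/
noncomputable def normbmo (a : L2 τ) : ℝ≥0∞ :=
  max (normbmoc τ F a) (max (normbmor τ F a) (normbmod τ F a))

end Martingale

end NCMart

/-!
The comparison of `BMO^c` with `bmo^c ∩ bmo^d` rests on the orthogonal decomposition
`a - E_{n-1}(a) = (a - E_n(a)) + da_n`, where `da_n` belongs to `L₂(M_n)` and `a - E_n(a)` is
orthogonal to `L₂(M_n)`. As `L₂(M_n)` is a right module over `M_n`, the mixed terms vanish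
(`inner_add_rmul_add`), which reads `E_n(|a - E_{n-1}(a)|²) = E_n(|a - E_n(a)|²) + |da_n|²`. Both
summands on the right are positive, hence each is bounded by the left side, and the left side is
bounded by the sum of their norms; this gives the constants `1` and `√2`. The row version follows
by taking adjoints, which commute with the conditional expectations (`condExpL2_adj`).

A bound on the left side has to produce elements of the algebra: `da_n` is a priori a vector of
`L₂(M_n)` with `‖da_n x‖₂ ≤ C ‖x‖₂` for `x ∈ M_n`, and it must be shown to belong to `M_n` with
operator norm at most `C`. This is `exists_toL2_eq_of_leftBounded`. The ball of radius `C` of a von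
Neumann algebra is weak-* compact (`isCompact_closedBall_weakStar`), so by normality of the trace
its image in `L₂` is closed (`isClosed_ballL2`). By Hahn–Banach a vector `ξ` outside it would be
separated from it by some `z` in the algebra, which contradicts the duality
`|⟨z, ξ⟩| ≤ C ‖z‖₁ = sup {Re ⟨z, y⟩ : ‖y‖ ≤ C}`; the latter is `exists_norm_inner_le`. The same
result bounds the operator norm of the element `y - |da_n|²` that represents
`E_n(|a - E_n(a)|²)` when `y` represents `E_n(|a - E_{n-1}(a)|²)`.
-/

namespace NCMart

/-! ### Weak-* compactness of balls -/

section Compactness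

open Filter Topology

variable {H : Type*} [NormedAddCommGroup H] [InnerProductSpace ℂ H] [CompleteSpace H]

/-- Along an ultrafilter, a bounded family of operators converges in the weak operator topology. -/
theorem exists_forall_tendsto_inner {ι : Type*} (u : Ultrafilter ι) (X : ι → H →L[ℂ] H) {C : ℝ}
    (hC : 0 ≤ C) (hX : ∀ᶠ i in (u : Filter ι), ‖X i‖ ≤ C) :
    ∃ T : H →L[ℂ] H, ‖T‖ ≤ C ∧
      ∀ v w : H, Tendsto (fun i => ⟪X i v, w⟫_ℂ) u (𝓝 ⟪T v, w⟫_ℂ) := by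
  have hb : ∀ v w : H, ∀ᶠ i in (u : Filter ι), ‖⟪X i v, w⟫_ℂ‖ ≤ C * ‖v‖ * ‖w‖ := fun v w =>
    hX.mono fun i hi => (norm_inner_le_norm _ _).trans
      (mul_le_mul_of_nonneg_right ((X i).le_of_opNorm_le hi v) (norm_nonneg _))
  have hlim : ∀ v w : H, ∃ l : ℂ, Tendsto (fun i => ⟪X i v, w⟫_ℂ) u (𝓝 l) := fun v w => by
    obtain ⟨l, -, hl⟩ := isCompact_iff_ultrafilter_le_nhds.1
      (isCompact_closedBall (0 : ℂ) (C * ‖v‖ * ‖w‖)) (u.map fun i => ⟪X i v, w⟫_ℂ) (by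
        rw [le_principal_iff]
        exact (hb v w).mono fun i hi => mem_closedBall_zero_iff.2 hi)
    exact ⟨l, hl⟩
  choose L hL using hlim
  let B : H →L⋆[ℂ] H →L[ℂ] ℂ := LinearMap.mkContinuous₂
    (LinearMap.mk₂'ₛₗ (starRingEnd ℂ) (RingHom.id ℂ) L
      (fun v₁ v₂ w => tendsto_nhds_unique (hL (v₁ + v₂) w)
        (((hL v₁ w).add (hL v₂ w)).congr fun i => by rw [map_add, inner_add_left]))
      (fun c v w => tendsto_nhds_unique (hL (c • v) w)
        (((hL v w).const_smul _).congr fun i => by rw [map_smul, inner_smul_left]; rfl))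
      (fun v w₁ w₂ => tendsto_nhds_unique (hL v (w₁ + w₂))
        (((hL v w₁).add (hL v w₂)).congr fun i => by rw [inner_add_right]))
      (fun c v w => tendsto_nhds_unique (hL v (c • w))
        (((hL v w).const_smul _).congr fun i => by rw [inner_smul_right]; rfl)))
    C (fun v w => le_of_tendsto (hL v w).norm (hb v w))
  have hB : ∀ v w, ⟪InnerProductSpace.continuousLinearMapOfBilin B v, w⟫_ℂ = L v w := fun v w => by
    rw [InnerProductSpace.continuousLinearMapOfBilin_apply]; rfl
  refine ⟨InnerProductSpace.continuousLinearMapOfBilin B, ?_, fun v w => by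
    rw [hB]; exact hL v w⟩
  refine ContinuousLinearMap.opNorm_le_of_re_inner_le hC fun v w hv hw => ?_
  have h1 := le_of_tendsto (hL v w).norm (hb v w)
  rw [hv, hw, mul_one, mul_one] at h1
  rw [hB]
  exact (Complex.re_le_norm _).trans h1

/-- The weak operator and the ultraweak topology agree on bounded sets. -/
theorem tendsto_weakStar_of_tendsto_inner {N : VonNeumannAlgebra H} {u : Filter N} {T : N} {C : ℝ}
    (hX : ∀ᶠ x in u, ‖x‖ ≤ C)
    (h : ∀ v w : H, Tendsto (fun x : N => ⟪(x : H →L[ℂ] H) v, w⟫_ℂ) u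
      (𝓝 ⟪(T : H →L[ℂ] H) v, w⟫_ℂ)) :
    u ≤ @nhds N (weakStar N) T := by
  rw [@nhds_induced _ _ (ultraweakTopology H), ← tendsto_iff_comap]
  simp only [nhds_iInf, nhds_induced, tendsto_iInf, tendsto_comap_iff]
  intro ξ η
  have h' : ∀ v w : H, Tendsto (fun x : N => ⟪v, (x : H →L[ℂ] H) w⟫_ℂ) u
      (𝓝 ⟪v, (T : H →L[ℂ] H) w⟫_ℂ) := fun v w => by
    simpa only [Function.comp_def, RCLike.star_def, inner_conj_symm] using (h w v).star
  have hs : Summable fun i => C * (‖ξ i‖ * ‖η i‖) :=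
    (lp.summable_mul (p := 2) (q := 2)
      (by simpa using Real.HolderConjugate.two_two) ξ η).mul_left C
  refine tendsto_tsum_of_dominated_convergence hs (fun i => h' _ _) ?_
  filter_upwards [hX] with x hx i
  calc ‖⟪ξ i, (x : H →L[ℂ] H) (η i)⟫_ℂ‖ ≤ ‖ξ i‖ * (C * ‖η i‖) :=
        (norm_inner_le_norm _ _).trans (mul_le_mul_of_nonneg_left
          ((x : H →L[ℂ] H).le_of_opNorm_le hx _) (norm_nonneg _))
    _ = C * (‖ξ i‖ * ‖η i‖) := by ring

/-- A von Neumann algebra, being its own double commutant, is closed under weak operator limits;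
with the ultrafilter limits of bounded families of operators this makes its balls compact. -/
theorem isCompact_closedBall_weakStar (N : VonNeumannAlgebra H) {C : ℝ} (hC : 0 ≤ C) :
    @IsCompact N (weakStar N) (Metric.closedBall 0 C) := by
  let _ := weakStar N
  refine isCompact_iff_ultrafilter_le_nhds.2 fun u hu => ?_
  have hX : ∀ᶠ x in (u : Filter N), ‖x‖ ≤ C :=
    Eventually.mono (le_principal_iff.1 hu) fun x hx => mem_closedBall_zero_iff.1 hx
  obtain ⟨T, hT, hlim⟩ := exists_forall_tendsto_inner u (fun x : N => (x : H →L[ℂ] H)) hC hX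
  have hmem : T ∈ N := by
    rw [← VonNeumannAlgebra.commutant_commutant N, VonNeumannAlgebra.mem_commutant_iff]
    intro g hg
    ext v
    refine ext_inner_right ℂ fun w => ?_
    rw [mul_apply_eq_comp, mul_apply_eq_comp, ← ContinuousLinearMap.adjoint_inner_right]
    refine tendsto_nhds_unique (hlim v _) ((hlim (g v) w).congr fun x => ?_)
    rw [ContinuousLinearMap.adjoint_inner_right]
    have := VonNeumannAlgebra.mem_commutant_iff.1 hg x x.2
    exact congrArg (⟪· , w⟫_ℂ) (DFunLike.congr_fun this v)
  exact ⟨⟨T, hmem⟩, mem_closedBall_zero_iff.2 hT,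
    tendsto_weakStar_of_tendsto_inner hX hlim⟩

end Compactness

/-! ### Balls of a subalgebra inside `L₂(M)` -/

section Balls

open Filter Topology

variable {H : Type*} [NormedAddCommGroup H] [InnerProductSpace ℂ H] [CompleteSpace H]
  {M N : VonNeumannAlgebra H}

theorem continuous_weakStar_mul_left (w : M) :
    @Continuous M M (weakStar M) (weakStar M) (fun x => w * x) := by
  refine (@continuous_induced_rng _ _ _ _ _ (ultraweakTopology H) (weakStar M)).2
    (continuous_iInf_rng.2 fun ξ => continuous_iInf_rng.2 fun η => continuous_induced_rng.2 ?_)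
  -- the adjoint of `w` is moved to the first sequence of vectors
  have hmem : Memℓp (fun i => star (w : H →L[ℂ] H) (ξ i)) 2 := by
    refine memℓp_gen ?_
    refine Summable.of_nonneg_of_le (fun i => by positivity) (fun i => ?_)
      (((lp.memℓp ξ).summable (by norm_num)).mul_left (‖star (w : H →L[ℂ] H)‖ ^ (2 : ℝ)))
    rw [ENNReal.toReal_ofNat, ← Real.mul_rpow (norm_nonneg _) (norm_nonneg _)]
    exact Real.rpow_le_rpow (norm_nonneg _) (ContinuousLinearMap.le_opNorm _ _) (by norm_num)
  have hc : @Continuous M ℂ (weakStar M) _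
      (fun x : M => ∑' i, ⟪star (w : H →L[ℂ] H) (ξ i), (x : H →L[ℂ] H) (η i)⟫_ℂ) := by
    have h1 : @Continuous _ ℂ (ultraweakTopology H) _
        (fun x : H →L[ℂ] H => ∑' i, ⟪star (w : H →L[ℂ] H) (ξ i), x (η i)⟫_ℂ) :=
      continuous_iInf_dom (i := (⟨_, hmem⟩ : lp (fun _ : ℕ => H) 2))
        (continuous_iInf_dom (i := η) continuous_induced_dom)
    exact @Continuous.comp _ _ _ (weakStar M) (ultraweakTopology H) _ _ _ h1
      (@continuous_induced_dom _ _ _ (ultraweakTopology H))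
  refine (@continuous_congr _ _ (weakStar M) _ _ _ fun x => tsum_congr fun i => ?_).1 hc
  rw [ContinuousLinearMap.star_eq_adjoint, ContinuousLinearMap.adjoint_inner_left]
  rfl

variable (τ : NormalTrace M) (h : N ≤ M)

theorem inner_toL2 (x y : M) : ⟪toL2 τ x, toL2 τ y⟫_ℂ = τ (star x * y) := by
  rw [toL2_apply, toL2_apply, Completion.inner_coe, inner_toPre]

theorem continuous_weakStar_inner_toL2 (w : M) :
    @Continuous N ℂ (weakStar N) _ (fun x : N => ⟪toL2 τ w, toL2 τ (incl h x)⟫_ℂ) := by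
  have h1 : @Continuous N M (weakStar N) (weakStar M) (fun x : N => incl h x) :=
    continuous_induced_rng.2 (@continuous_induced_dom _ _ _ (ultraweakTopology H))
  have h2 : @Continuous M ℂ (weakStar M) _ (fun x => τ (star w * x)) :=
    @Continuous.comp _ _ _ (weakStar M) (weakStar M) _ _ _ τ.normal
      (continuous_weakStar_mul_left (star w))
  simp only [inner_toL2]
  exact @Continuous.comp N M ℂ (weakStar N) (weakStar M) _ (fun x => incl h x)
    (fun x => τ (star w * x)) h2 h1

theorem denseRange_toL2 : DenseRange (toL2 τ) :=
  (Completion.denseRange_coe (α := PreL2 τ))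

theorem toL2_injective : Function.Injective (toL2 τ) := fun _ _ hxy =>
  (toPre τ).injective (Completion.coe_injective _ hxy)

/-- The image in `L₂(M)` of the ball of radius `C` of `N`. -/
def ballL2 (C : ℝ) : Set (L2 τ) := {b | ∃ y : N, ‖y‖ ≤ C ∧ toL2 τ (incl h y) = b}

theorem convex_ballL2 (C : ℝ) : Convex ℝ (ballL2 τ h C) := by
  have : ballL2 τ h C = ((toL2 τ).toLinearMap ∘ₗ (incl h).toLinearMap).restrictScalars ℝ ''
      Metric.closedBall 0 C := by
    ext b
    simp [ballL2]
  rw [this]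
  exact (convex_closedBall _ _).linear_image _

/-- The balls of `N` are closed for `‖·‖₂`: an `L₂`-limit of elements of a ball agrees with any of
their weak-* cluster points, because the trace is normal. -/
theorem isClosed_ballL2 {C : ℝ} (hC : 0 ≤ C) : IsClosed (ballL2 τ h C) := by
  refine isClosed_iff_ultrafilter.2 fun ξ u hu hS => ?_
  have hex : ∀ b : L2 τ, ∃ y : N, ‖y‖ ≤ C ∧ (b ∈ ballL2 τ h C → toL2 τ (incl h y) = b) := by
    intro b
    by_cases hb : b ∈ ballL2 τ h C
    · obtain ⟨y, hy, rfl⟩ := hb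
      exact ⟨y, hy, fun _ => rfl⟩
    · exact ⟨0, by simpa using hC, fun h' => absurd h' hb⟩
  choose Y hYC hY using hex
  let _ := weakStar N
  obtain ⟨y, hy, hlim⟩ := isCompact_iff_ultrafilter_le_nhds.1 (isCompact_closedBall_weakStar N hC)
    (u.map Y) (by
      rw [le_principal_iff, Ultrafilter.coe_map, mem_map]
      exact Eventually.of_forall fun b => mem_closedBall_zero_iff.2 (hYC b))
  refine ⟨y, mem_closedBall_zero_iff.1 hy, ?_⟩
  have hw : ∀ w : M, ⟪toL2 τ w, toL2 τ (incl h y)⟫_ℂ = ⟪toL2 τ w, ξ⟫_ℂ := fun w => by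
    have h1 : Tendsto (fun b => ⟪toL2 τ w, toL2 τ (incl h (Y b))⟫_ℂ) u
        (𝓝 ⟪toL2 τ w, toL2 τ (incl h y)⟫_ℂ) :=
      ((continuous_weakStar_inner_toL2 τ h w).tendsto y).comp hlim
    have h2 : Tendsto (fun b => ⟪toL2 τ w, b⟫_ℂ) u (𝓝 ⟪toL2 τ w, ξ⟫_ℂ) :=
      ((innerSL ℂ (toL2 τ w)).continuous.tendsto ξ).comp hu
    refine tendsto_nhds_unique h1 (h2.congr' ?_)
    filter_upwards [hS] with b hb
    rw [hY b hb]
  refine ext_inner_left ℂ fun v => ?_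
  refine (denseRange_toL2 τ).induction_on v
    (isClosed_eq (continuous_id.inner continuous_const) (continuous_id.inner continuous_const)) hw

end Balls

end NCMart

namespace NCMart

/-! ### Right multiplication on `L₂(M)` -/

section RightMultiplication

variable {H : Type*} [NormedAddCommGroup H] [InnerProductSpace ℂ H] [CompleteSpace H]
  {M N : VonNeumannAlgebra H} (τ : NormalTrace M) (h : N ≤ M)

theorem rmul_toL2 (x y : M) : rmul τ x (toL2 τ y) = toL2 τ (y * x) := by
  rw [toL2_apply, rmul_coe, toL2_apply]

theorem inner_rmul_left (x : M) (a b : L2 τ) :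
    ⟪rmul τ x a, b⟫_ℂ = ⟪a, rmul τ (star x) b⟫_ℂ := by
  refine (denseRange_toL2 τ).induction_on₂ (p := fun a b =>
    ⟪rmul τ x a, b⟫_ℂ = ⟪a, rmul τ (star x) b⟫_ℂ) ?_ (fun y z => ?_) a b
  · exact isClosed_eq (by fun_prop) (by fun_prop)
  · rw [rmul_toL2, rmul_toL2, inner_toL2, inner_toL2, star_mul, mul_assoc, τ.tracial, mul_assoc]

theorem rmul_rmul (x y : M) (a : L2 τ) : rmul τ x (rmul τ y a) = rmul τ (y * x) a := by
  refine (denseRange_toL2 τ).induction_on (p := fun a =>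
    rmul τ x (rmul τ y a) = rmul τ (y * x) a) a ?_ (fun z => ?_)
  · exact isClosed_eq (by fun_prop) (by fun_prop)
  · rw [rmul_toL2, rmul_toL2, rmul_toL2, mul_assoc]

theorem norm_toL2_star (x : M) : ‖toL2 τ (star x)‖ = ‖toL2 τ x‖ := by
  rw [toL2_apply, toL2_apply, Completion.norm_coe, Completion.norm_coe, norm_toPre_star]

theorem norm_toL2_mul_le (x y : M) : ‖toL2 τ (x * y)‖ ≤ ‖x‖ * ‖toL2 τ y‖ := by
  rw [toL2_apply, toL2_apply, Completion.norm_coe, Completion.norm_coe]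
  exact norm_toPre_mul_left τ x y

theorem norm_toL2_le (x : M) : ‖toL2 τ x‖ ≤ ‖x‖ := by
  rw [toL2_apply, Completion.norm_coe]
  exact norm_toPre_le τ x

theorem norm_toL2_sq (x : M) : ((‖toL2 τ x‖ ^ 2 : ℝ) : ℂ) = τ (star x * x) := by
  rw [toL2_apply, Completion.norm_coe, norm_toPre_sq]

theorem toL2_incl_mem (x : N) : toL2 τ (incl h x) ∈ subL2 τ h :=
  Submodule.le_topologicalClosure _ ⟨x, rfl⟩

/-- To prove a closed property of the elements of `L₂(N)` it suffices to consider those of `N`. -/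
theorem subL2_induction {p : L2 τ → Prop} (hp : IsClosed {b | p b})
    (ih : ∀ x : N, p (toL2 τ (incl h x))) {b : L2 τ} (hb : b ∈ subL2 τ h) : p b :=
  closure_minimal (by rintro _ ⟨x, rfl⟩; exact ih x) hp hb

theorem rmul_mem_subL2 (x : N) {b : L2 τ} (hb : b ∈ subL2 τ h) :
    rmul τ (incl h x) b ∈ subL2 τ h := by
  refine subL2_induction τ h (p := fun b => rmul τ (incl h x) b ∈ subL2 τ h)
    ((Submodule.isClosed_topologicalClosure _).preimage (map_continuous _)) (fun y => ?_) hb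
  rw [rmul_toL2]
  exact toL2_incl_mem τ h (y * x)

end RightMultiplication

/-! ### Left bounded vectors -/

section LeftBounded

variable {H : Type*} [NormedAddCommGroup H] [InnerProductSpace ℂ H] [CompleteSpace H]
  {M N : VonNeumannAlgebra H}

/-- A regularized fourth root `k = (a + ε²)^{1/4}` of a positive operator, and its inverse `l`. -/
theorem exists_regularized_fourth_root {a : H →L[ℂ] H} (ha : 0 ≤ a) {ε : ℝ} (hε : 0 < ε) :
    ∃ k l : H →L[ℂ] H, star k = k ∧ star l = l ∧ k * l = 1 ∧ l * k = 1 ∧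
      k * k * (k * k) = a + ((ε ^ 2 : ℝ) : ℂ) • 1 ∧ ε * ‖l‖ ^ 2 ≤ 1 ∧
      ∀ g, Commute a g → Commute k g ∧ Commute l g := by
  -- the absolute value makes the functions continuous on the whole line
  have hpos : ∀ t : ℝ, 0 < √√(|t| + ε ^ 2) := fun t => by positivity
  have hf : Continuous fun t : ℝ => √√(|t| + ε ^ 2) := by fun_prop
  have hff : Continuous fun t : ℝ => √√(|t| + ε ^ 2) * √√(|t| + ε ^ 2) := hf.mul hf
  have hg : Continuous fun t : ℝ => (√√(|t| + ε ^ 2))⁻¹ := hf.inv₀ fun t => (hpos t).ne'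
  have hkl : cfc (fun t : ℝ => √√(|t| + ε ^ 2)) a * cfc (fun t : ℝ => (√√(|t| + ε ^ 2))⁻¹) a
      = 1 := by
    rw [← cfc_mul _ _ a hf.continuousOn hg.continuousOn, ← cfc_const_one ℝ a]
    exact cfc_congr fun t _ => mul_inv_cancel₀ (hpos t).ne'
  refine ⟨cfc (fun t : ℝ => √√(|t| + ε ^ 2)) a, cfc (fun t : ℝ => (√√(|t| + ε ^ 2))⁻¹) a,
    (cfc_predicate _ a : IsSelfAdjoint _).star_eq, (cfc_predicate _ a : IsSelfAdjoint _).star_eq,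
    hkl, ?_, ?_, ?_, fun g hg => ⟨hg.cfc_real _, hg.cfc_real _⟩⟩
  · rw [← hkl]
    exact cfc_commute_cfc _ _ a
  · have h1 : a + ((ε ^ 2 : ℝ) : ℂ) • (1 : H →L[ℂ] H) = cfc (fun t : ℝ => t + ε ^ 2) a := by
      rw [cfc_add_const _ _ a, cfc_id' ℝ a, Algebra.algebraMap_eq_smul_one]
      rfl
    rw [h1, ← cfc_mul _ _ a hf.continuousOn hf.continuousOn,
      ← cfc_mul _ _ a hff.continuousOn hff.continuousOn]
    refine cfc_congr fun t ht => ?_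
    have ht0 : 0 ≤ t := spectrum_nonneg_of_nonneg ha ht
    rw [Real.mul_self_sqrt (by positivity), Real.mul_self_sqrt (by positivity), abs_of_nonneg ht0]
  · have h1 : ‖cfc (fun t : ℝ => (√√(|t| + ε ^ 2))⁻¹) a‖ ≤ (√ε)⁻¹ := by
      refine norm_cfc_le (by positivity) fun t _ => ?_
      rw [Real.norm_of_nonneg (by positivity)]
      refine inv_anti₀ (by positivity) (Real.sqrt_le_sqrt (Real.le_sqrt_of_sq_le ?_))
      linarith [abs_nonneg t]
    calc _ ≤ ε * (√ε)⁻¹ ^ 2 := by gcongr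
      _ = 1 := by rw [inv_pow, Real.sq_sqrt hε.le, mul_inv_cancel₀ hε.ne']

variable (τ : NormalTrace M) (h : N ≤ M)

theorem mem_of_forall_commute {a b : H →L[ℂ] H} (ha : a ∈ N)
    (hb : ∀ g, Commute a g → Commute b g) : b ∈ N := by
  rw [← VonNeumannAlgebra.commutant_commutant N, VonNeumannAlgebra.mem_commutant_iff]
  intro g hg
  exact (hb g (VonNeumannAlgebra.mem_commutant_iff.1 hg a ha)).eq.symm

/-- The duality `|⟨z, ξ⟩| ≤ C ‖z‖₁` for a vector `ξ` that is left bounded by `C`, up to `ε`. In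
place of the polar decomposition of `z` one uses `k = (zz* + ε²)^{1/4}` and its inverse `l`: on one
hand `⟨z, ξ⟩ = ⟨k, ξ (lz)*⟩`, on the other hand `u = l² z` is a contraction for which `⟨z, u⟩` is
approximately `‖k‖₂ ‖(lz)*‖₂`. -/
theorem exists_norm_inner_le {ξ : L2 τ} {C : ℝ} (hC : 0 ≤ C)
    (hξ : ∀ x : N, ‖rmul τ (incl h x) ξ‖ ≤ C * ‖toL2 τ (incl h x)‖) (z : N) {ε : ℝ} (hε : 0 < ε) :
    ∃ y : N, ‖y‖ ≤ C ∧ ‖⟪toL2 τ (incl h z), ξ⟫_ℂ‖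
      ≤ (⟪toL2 τ (incl h z), toL2 τ (incl h y)⟫_ℂ).re + C * ε := by
  obtain ⟨k, l, hk, hl, hkl, hlk, hk4, hle, hcomm⟩ := exists_regularized_fourth_root
    (mul_star_self_nonneg (z : H →L[ℂ] H)) hε
  have hzz : (z : H →L[ℂ] H) * star (z : H →L[ℂ] H) ∈ N := mul_mem z.2 (star_mem z.2)
  lift k to N using mem_of_forall_commute hzz fun g hg => (hcomm g hg).1
  lift l to N using mem_of_forall_commute hzz fun g hg => (hcomm g hg).2
  replace hk : star k = k := Subtype.ext hk
  replace hl : star l = l := Subtype.ext hl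
  replace hkl : k * l = 1 := Subtype.ext hkl
  replace hlk : l * k = 1 := Subtype.ext hlk
  replace hk4 : k * k * (k * k) = z * star z + ((ε ^ 2 : ℝ) : ℂ) • 1 := Subtype.ext hk4
  have hzs : z * star z = k * k * (k * k) - ((ε ^ 2 : ℝ) : ℂ) • 1 := by rw [hk4]; abel
  have hww : l * (z * star z) * l = k * k - ((ε ^ 2 : ℝ) : ℂ) • (l * l) := by
    rw [hzs, mul_sub, sub_mul]
    simp only [mul_smul_comm, smul_mul_assoc, mul_one]
    congr 1
    calc l * (k * k * (k * k)) * l = (l * k) * k * k * (k * l) := by simp only [mul_assoc]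
      _ = k * k := by rw [hlk, hkl, one_mul, mul_one]
  set w : N := l * z with hw
  set u : N := l * (l * z) with hu
  have hsw : star w = star z * l := by rw [hw, star_mul, hl]
  -- `u u* = 1 - ε² l⁴`
  have hu1 : ‖u‖ ≤ 1 := by
    have h1 : u * star u = 1 - ((ε ^ 2 : ℝ) : ℂ) • (l * l * (l * l)) := by
      calc u * star u = l * (l * (z * star z) * l) * l := by
            rw [hu, star_mul, star_mul, hl]; simp only [mul_assoc]
        _ = 1 - ((ε ^ 2 : ℝ) : ℂ) • (l * l * (l * l)) := by
            rw [hww, mul_sub, sub_mul]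
            simp only [mul_smul_comm, smul_mul_assoc]
            congr 1
            · calc l * (k * k) * l = (l * k) * (k * l) := by simp only [mul_assoc]
                _ = 1 := by rw [hlk, hkl, one_mul]
    have h2 : (u : H →L[ℂ] H) * star (u : H →L[ℂ] H) ≤ 1 := by
      have h3 : (1 : H →L[ℂ] H) - u * star (u : H →L[ℂ] H)
          = star (((ε : ℂ) • (l * l) : N) : H →L[ℂ] H) * (((ε : ℂ) • (l * l) : N) : H →L[ℂ] H) := by
        have h4 : 1 - u * star u = star ((ε : ℂ) • (l * l)) * ((ε : ℂ) • (l * l)) := by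
          rw [h1, star_smul, star_mul, hl]
          simp only [smul_mul_assoc, mul_smul_comm, smul_smul, sub_sub_cancel]
          congr 1
          simp [sq]
        exact congrArg Subtype.val h4
      exact sub_nonneg.1 (h3 ▸ star_mul_self_nonneg _)
    have h5 := (CStarAlgebra.norm_le_one_iff_of_nonneg _
      (mul_star_self_nonneg (u : H →L[ℂ] H))).2 h2
    rw [CStarRing.norm_self_mul_star] at h5
    exact abs_norm u ▸ abs_le_one_iff_mul_self_le_one.2 h5
  -- `⟨z, u⟩ = τ(w w*) = ‖w‖₂²` and `‖k‖₂² = ‖w‖₂² + ε² ‖l‖₂²`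
  have hzu : ⟪toL2 τ (incl h z), toL2 τ (incl h u)⟫_ℂ = ((‖toL2 τ (incl h w)‖ ^ 2 : ℝ) : ℂ) := by
    rw [norm_toL2_sq, inner_toL2]
    have : star z * u = star w * w := by rw [hsw, hu, hw]; simp only [mul_assoc]
    exact congrArg (fun x => τ (incl h x)) this
  have hkw : ‖toL2 τ (incl h k)‖ ^ 2 ≤ ‖toL2 τ (incl h w)‖ ^ 2 + ε := by
    have h1 : k * k = w * star w + ((ε ^ 2 : ℝ) : ℂ) • (l * l) := by
      rw [← sub_eq_iff_eq_add, ← hww, hsw, hw]; simp only [mul_assoc]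
    have h2 : τ (star (incl h k) * incl h k)
        = τ (star (star (incl h w)) * star (incl h w))
          + ((ε ^ 2 : ℝ) : ℂ) * τ (star (incl h l) * incl h l) := by
      have h3 : star (incl h k) = incl h k := congrArg (incl h) hk
      have h4 : star (incl h l) = incl h l := congrArg (incl h) hl
      rw [h3, h4, star_star]
      calc τ (incl h (k * k))
          = τ (incl h (w * star w) + ((ε ^ 2 : ℝ) : ℂ) • incl h (l * l)) :=
            congrArg (fun x => τ (incl h x)) h1
        _ = _ := by rw [map_add, map_smul]; rfl
    rw [← norm_toL2_sq, ← norm_toL2_sq, ← norm_toL2_sq, norm_toL2_star] at h2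
    have h5 : ‖toL2 τ (incl h k)‖ ^ 2
        = ‖toL2 τ (incl h w)‖ ^ 2 + ε ^ 2 * ‖toL2 τ (incl h l)‖ ^ 2 := by exact_mod_cast h2
    have h6 : ‖toL2 τ (incl h l)‖ ^ 2 ≤ ‖l‖ ^ 2 := by
      have := norm_toL2_le τ (incl h l)
      rw [(incl h).norm_map] at this
      gcongr
    have h7 : ε ^ 2 * ‖toL2 τ (incl h l)‖ ^ 2 ≤ ε := by
      calc ε ^ 2 * ‖toL2 τ (incl h l)‖ ^ 2 ≤ ε ^ 2 * ‖l‖ ^ 2 := by gcongr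
        _ = ε * (ε * ‖l‖ ^ 2) := by ring
        _ ≤ ε * 1 := mul_le_mul_of_nonneg_left hle hε.le
        _ = ε := mul_one ε
    linarith
  have hzξ : ⟪toL2 τ (incl h z), ξ⟫_ℂ
      = ⟪toL2 τ (incl h k), rmul τ (incl h (star w)) ξ⟫_ℂ := by
    have h1 : star (incl h w) = incl h (star w) := rfl
    rw [← h1, ← inner_rmul_left, rmul_toL2]
    have h2 : z = k * w := by rw [hw, ← mul_assoc, hkl, one_mul]
    conv_lhs => rw [h2]
    rfl
  refine ⟨(C : ℂ) • u, ?_, ?_⟩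
  · rw [norm_smul, Complex.norm_real, Real.norm_of_nonneg hC]
    exact mul_le_of_le_one_right hC hu1
  · rw [map_smul, map_smul, inner_smul_right, hzu, ← Complex.ofReal_mul, Complex.ofReal_re, hzξ]
    have h1 : ‖toL2 τ (incl h (star w))‖ = ‖toL2 τ (incl h w)‖ := norm_toL2_star τ (incl h w)
    have h2 : ‖toL2 τ (incl h k)‖ * ‖toL2 τ (incl h w)‖ ≤ ‖toL2 τ (incl h w)‖ ^ 2 + ε := by
      nlinarith [two_mul_le_add_sq ‖toL2 τ (incl h k)‖ ‖toL2 τ (incl h w)‖]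
    calc _ ≤ ‖toL2 τ (incl h k)‖ * (C * ‖toL2 τ (incl h (star w))‖) :=
          (norm_inner_le_norm _ _).trans
            (mul_le_mul_of_nonneg_left (hξ (star w)) (norm_nonneg _))
      _ = C * (‖toL2 τ (incl h k)‖ * ‖toL2 τ (incl h w)‖) := by rw [h1]; ring
      _ ≤ C * (‖toL2 τ (incl h w)‖ ^ 2 + ε) := by gcongr
      _ = _ := by ring

/-- A left bounded vector of `L₂(N)` belongs to `N`. The vector cannot be separated from the closed
convex set of the elements of `N` of norm at most `C`. -/
theorem exists_toL2_eq_of_leftBounded {ξ : L2 τ} (hmem : ξ ∈ subL2 τ h) {C : ℝ} (hC : 0 ≤ C)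
    (hξ : ∀ x : N, ‖rmul τ (incl h x) ξ‖ ≤ C * ‖toL2 τ (incl h x)‖) :
    ∃ y : N, ‖y‖ ≤ C ∧ toL2 τ (incl h y) = ξ := by
  by_contra hcon
  obtain ⟨f, s, hfs, hsf⟩ := RCLike.geometric_hahn_banach_closed_point (𝕜 := ℂ)
    (convex_ballL2 τ h C) (isClosed_ballL2 τ h hC) (x := ξ) hcon
  set η : L2 τ := condExpL2 τ h ((InnerProductSpace.toDual ℂ (L2 τ)).symm f) with hη
  have hfη : ∀ b ∈ subL2 τ h, f b = ⟪η, b⟫_ℂ := fun b hb => by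
    rw [hη, condExpL2, Submodule.inner_starProjection_left_eq_right,
      Submodule.starProjection_eq_self_iff.2 hb, InnerProductSpace.toDual_symm_apply]
  have hηm : η ∈ subL2 τ h := Submodule.starProjection_apply_mem _ _
  have hgap : 0 < (f ξ).re - s := sub_pos.2 hsf
  -- passing from `η` to `z` costs `ε ‖ξ‖` at `ξ` and `ε C` on the ball;
  -- the duality costs another `C ε`
  set ε : ℝ := ((f ξ).re - s) / (2 * C + ‖ξ‖ + 1) with hεdef
  have hε : 0 < ε := by positivity
  have hεgap : ε * (2 * C + ‖ξ‖ + 1) = (f ξ).re - s := div_mul_cancel₀ _ (by positivity)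
  obtain ⟨z, hz⟩ : ∃ z : N, ‖η - toL2 τ (incl h z)‖ < ε := by
    obtain ⟨_, ⟨z, rfl⟩, hz⟩ := Metric.mem_closure_iff.1 hηm ε hε
    exact ⟨z, by rwa [dist_eq_norm] at hz⟩
  obtain ⟨y, hy, hle⟩ := exists_norm_inner_le τ h hC hξ z hε
  have h1 := hfs _ ⟨y, hy, rfl⟩
  rw [hfη _ (toL2_incl_mem τ h y)] at h1
  have h2 : ∀ b : L2 τ, ‖⟪η, b⟫_ℂ - ⟪toL2 τ (incl h z), b⟫_ℂ‖ ≤ ε * ‖b‖ := fun b => by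
    rw [← inner_sub_left]
    exact (norm_inner_le_norm _ _).trans (mul_le_mul_of_nonneg_right hz.le (norm_nonneg _))
  have h3 := (abs_le.1 ((Complex.abs_re_le_norm _).trans (h2 ξ))).2
  have h4 := (abs_le.1 ((Complex.abs_re_le_norm _).trans (h2 (toL2 τ (incl h y))))).1
  have h5 : ‖toL2 τ (incl h y)‖ ≤ C := (norm_toL2_le τ _).trans hy
  have h6 : ε * ‖toL2 τ (incl h y)‖ ≤ ε * C := mul_le_mul_of_nonneg_left h5 hε.le
  have h7 := Complex.re_le_norm ⟪toL2 τ (incl h z), ξ⟫_ℂ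
  rw [hfη ξ hmem] at hεgap
  rw [Complex.sub_re] at h3 h4
  change (⟪η, toL2 τ (incl h y)⟫_ℂ).re < s at h1
  nlinarith

end LeftBounded

end NCMart

namespace NCMart

/-! ### Conditional expectations and the norm of `L_∞` -/

section Conditional

variable {H : Type*} [NormedAddCommGroup H] [InnerProductSpace ℂ H] [CompleteSpace H]
  {M N : VonNeumannAlgebra H} (τ : NormalTrace M) (h : N ≤ M)

theorem linftyNormL2_toL2 (y : M) : linftyNormL2 τ (toL2 τ y) = ‖y‖ₑ :=
  le_antisymm (iInf₂_le (f := fun z (_ : toL2 τ z = toL2 τ y) => ‖z‖ₑ) y rfl)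
    (le_iInf₂ fun _ hz => by rw [toL2_injective τ hz])

theorem linftyNormL2_lt_top_iff {a : L2 τ} : linftyNormL2 τ a < ∞ ↔ ∃ y, toL2 τ y = a := by
  refine ⟨fun ha => ?_, ?_⟩
  · simp only [linftyNormL2, iInf_lt_iff] at ha
    obtain ⟨y, hy, -⟩ := ha
    exact ⟨y, hy⟩
  · rintro ⟨y, rfl⟩
    rw [linftyNormL2_toL2]
    exact enorm_lt_top

theorem toL1_eq_condExpL1_absSq_iff (y : N) (b : L2 τ) :
    toL1 (τ.restrict h) y = condExpL1 τ h (absSq τ b) ↔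
      ∀ x : N, τ (incl h (y * x)) = ⟪b, rmul τ (incl h x) b⟫_ℂ := by
  rw [Subtype.ext_iff, ContinuousLinearMap.ext_iff]
  refine forall_congr' fun x => ?_
  have h1 : (toL1 (τ.restrict h) y : StrongDual ℂ N) x = τ (incl h (y * x)) :=
    traceFun_apply (τ.restrict h) y x
  rw [h1]
  rfl

theorem inner_rmul_rmul (x y : M) (b : L2 τ) :
    ⟪rmul τ x b, rmul τ y b⟫_ℂ = ⟪b, rmul τ (y * star x) b⟫_ℂ := by
  rw [inner_rmul_left, rmul_rmul]

/-- If `E(|b|²) = y`, then `‖b x‖₂² = τ(x* y x) ≤ ‖y‖ ‖x‖₂²`. -/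
theorem norm_rmul_le_of_condExpL1_eq {y : N} {b : L2 τ}
    (hy : toL1 (τ.restrict h) y = condExpL1 τ h (absSq τ b)) (x : N) :
    ‖rmul τ (incl h x) b‖ ≤ √‖y‖ * ‖toL2 τ (incl h x)‖ := by
  rw [toL1_eq_condExpL1_absSq_iff] at hy
  have h1 : ((‖rmul τ (incl h x) b‖ ^ 2 : ℝ) : ℂ)
      = ⟪toL2 τ (incl h x), toL2 τ (incl h y * incl h x)⟫_ℂ := by
    have h2 : ⟪rmul τ (incl h x) b, rmul τ (incl h x) b⟫_ℂ
        = ((‖rmul τ (incl h x) b‖ ^ 2 : ℝ) : ℂ) := by rw [inner_self_eq_norm_sq_to_K]; simp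
    rw [← h2, inner_rmul_rmul, inner_toL2, τ.tracial, mul_assoc]
    exact (hy (x * star x)).symm
  have h3 : ‖rmul τ (incl h x) b‖ ^ 2
      ≤ ‖toL2 τ (incl h x)‖ * (‖y‖ * ‖toL2 τ (incl h x)‖) := by
    calc ‖rmul τ (incl h x) b‖ ^ 2 = ‖((‖rmul τ (incl h x) b‖ ^ 2 : ℝ) : ℂ)‖ := by
          rw [Complex.norm_real, Real.norm_of_nonneg (by positivity)]
      _ ≤ ‖toL2 τ (incl h x)‖ * ‖toL2 τ (incl h y * incl h x)‖ := by
          rw [h1]; exact norm_inner_le_norm _ _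
      _ ≤ _ := mul_le_mul_of_nonneg_left (norm_toL2_mul_le τ _ _) (norm_nonneg _)
  refine (sq_le_sq₀ (norm_nonneg _) (by positivity)).1 ?_
  rw [mul_pow, Real.sq_sqrt (norm_nonneg _)]
  linarith

theorem linftyNormL2_le_of_leftBounded {ξ : L2 τ} (hmem : ξ ∈ subL2 τ h) {C : ℝ} (hC : 0 ≤ C)
    (hξ : ∀ x : N, ‖rmul τ (incl h x) ξ‖ ≤ C * ‖toL2 τ (incl h x)‖) :
    linftyNormL2 τ ξ ≤ ENNReal.ofReal C := by
  obtain ⟨y, hy, rfl⟩ := exists_toL2_eq_of_leftBounded τ h hmem hC hξ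
  rw [linftyNormL2_toL2, ← ofReal_norm]
  exact ENNReal.ofReal_le_ofReal hy

/-- `M ∩ L₂(N) = N`. -/
theorem exists_incl_of_toL2_mem {m : M} (hm : toL2 τ m ∈ subL2 τ h) : ∃ y : N, incl h y = m := by
  obtain ⟨y, -, hy⟩ := exists_toL2_eq_of_leftBounded τ h hm (norm_nonneg m) fun x => by
    rw [rmul_toL2]
    exact norm_toL2_mul_le τ m _
  exact ⟨y, toL2_injective τ hy⟩

variable {b d : L2 τ}

/-- `E(|b + d|²) = E(|b|²) + |d|²` for `b` orthogonal to `L₂(N)` and `d` in `L₂(N)`. -/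
theorem inner_add_rmul_add (hb : b ∈ (subL2 τ h)ᗮ) (hd : d ∈ subL2 τ h) (x : N) :
    ⟪b + d, rmul τ (incl h x) (b + d)⟫_ℂ
      = ⟪b, rmul τ (incl h x) b⟫_ℂ + ⟪d, rmul τ (incl h x) d⟫_ℂ := by
  have h1 : ⟪b, rmul τ (incl h x) d⟫_ℂ = 0 :=
    Submodule.inner_left_of_mem_orthogonal (rmul_mem_subL2 τ h x hd) hb
  have h2 : ⟪d, rmul τ (incl h x) b⟫_ℂ = 0 := by
    rw [← star_star (incl h x), ← inner_rmul_left]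
    exact Submodule.inner_right_of_mem_orthogonal (rmul_mem_subL2 τ h (star x) hd) hb
  rw [map_add, inner_add_left, inner_add_right, inner_add_right, h1, h2, zero_add, add_zero]

theorem norm_rmul_right_le_norm_rmul_add (hb : b ∈ (subL2 τ h)ᗮ) (hd : d ∈ subL2 τ h) (x : N) :
    ‖rmul τ (incl h x) d‖ ≤ ‖rmul τ (incl h x) (b + d)‖ ∧
      ‖rmul τ (incl h x) b‖ ≤ ‖rmul τ (incl h x) (b + d)‖ := by
  have h1 : ⟪rmul τ (incl h x) b, rmul τ (incl h x) d⟫_ℂ = 0 := by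
    rw [inner_rmul_left]
    exact Submodule.inner_left_of_mem_orthogonal
      (rmul_mem_subL2 τ h (star x) (rmul_mem_subL2 τ h x hd)) hb
  have h2 := norm_add_sq_eq_norm_sq_add_norm_sq_of_inner_eq_zero _ _ h1
  rw [← map_add] at h2
  constructor <;> nlinarith [norm_nonneg (rmul τ (incl h x) (b + d)),
    norm_nonneg (rmul τ (incl h x) b), norm_nonneg (rmul τ (incl h x) d)]

end Conditional

/-! ### One step of the filtration -/

section Step

variable {H : Type*} [NormedAddCommGroup H] [InnerProductSpace ℂ H] [CompleteSpace H]
  {M : VonNeumannAlgebra H} (τ : NormalTrace M) (F : VNFiltration M) {n : ℕ} {b d : L2 τ}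

theorem linftyNormL2_sq_le_condSqNorm_add (hb : b ∈ (subL2 τ (F.le n))ᗮ)
    (hd : d ∈ subL2 τ (F.le n)) : linftyNormL2 τ d ^ 2 ≤ condSqNorm τ F n (b + d) := by
  refine le_iInf₂ fun y hy => ?_
  have h1 := linftyNormL2_le_of_leftBounded τ (F.le n) hd (Real.sqrt_nonneg ‖y‖) fun x =>
    (norm_rmul_right_le_norm_rmul_add τ (F.le n) hb hd x).1.trans
      (norm_rmul_le_of_condExpL1_eq τ (F.le n) hy x)
  calc linftyNormL2 τ d ^ 2 ≤ ENNReal.ofReal √‖y‖ ^ 2 := by gcongr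
    _ = ‖y‖ₑ := by
      rw [← ENNReal.ofReal_pow (Real.sqrt_nonneg _), Real.sq_sqrt (norm_nonneg _), ofReal_norm]

/-- If `E_n(|b + d|²) = y`, then `d` is in `M_n` and `E_n(|b|²) = y - d* d`. This element has norm
at most `‖y‖`, since it gives the form `(v, x) ↦ ⟨b v, b x⟩` on `M_n`. -/
theorem condSqNorm_le_condSqNorm_add (hb : b ∈ (subL2 τ (F.le n))ᗮ)
    (hd : d ∈ subL2 τ (F.le n)) : condSqNorm τ F n b ≤ condSqNorm τ F n (b + d) := by
  refine le_iInf₂ fun y hy => ?_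
  have hle := norm_rmul_le_of_condExpL1_eq τ (F.le n) hy
  have hadd := norm_rmul_right_le_norm_rmul_add τ (F.le n) hb hd
  obtain ⟨m, -, rfl⟩ := exists_toL2_eq_of_leftBounded τ (F.le n) hd (Real.sqrt_nonneg ‖y‖)
    fun x => (hadd x).1.trans (hle x)
  set h := F.le n
  have hz : toL1 (τ.restrict h) (y - star m * m) = condExpL1 τ h (absSq τ b) := by
    rw [toL1_eq_condExpL1_absSq_iff] at hy ⊢
    intro x
    have h1 := hy x
    rw [inner_add_rmul_add τ h hb hd, rmul_toL2, inner_toL2] at h1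
    rw [← sub_eq_iff_eq_add] at h1
    rw [← h1, sub_mul, map_sub, map_sub, mul_assoc]
    rfl
  have hzx : ∀ x : F.alg n, ‖toL2 τ (incl h ((y - star m * m) * x))‖
      ≤ ‖y‖ * ‖toL2 τ (incl h x)‖ := fun x => by
    rw [toL1_eq_condExpL1_absSq_iff] at hz
    set v := (y - star m * m) * x with hv
    have h1 : ((‖toL2 τ (incl h v)‖ ^ 2 : ℝ) : ℂ)
        = ⟪rmul τ (incl h v) b, rmul τ (incl h x) b⟫_ℂ := by
      rw [inner_rmul_rmul, norm_toL2_sq, τ.tracial]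
      refine Eq.trans ?_ (hz (x * star v))
      rw [← mul_assoc]
      rfl
    have h2 : ‖toL2 τ (incl h v)‖ ^ 2
        ≤ (√‖y‖ * ‖toL2 τ (incl h v)‖) * (√‖y‖ * ‖toL2 τ (incl h x)‖) := by
      calc ‖toL2 τ (incl h v)‖ ^ 2 = ‖((‖toL2 τ (incl h v)‖ ^ 2 : ℝ) : ℂ)‖ := by
            rw [Complex.norm_real, Real.norm_of_nonneg (by positivity)]
        _ ≤ ‖rmul τ (incl h v) b‖ * ‖rmul τ (incl h x) b‖ := by
            rw [h1]; exact norm_inner_le_norm _ _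
        _ ≤ _ := mul_le_mul ((hadd v).2.trans (hle v)) ((hadd x).2.trans (hle x))
            (norm_nonneg _) (by positivity)
    have h3 : (√‖y‖ * ‖toL2 τ (incl h v)‖) * (√‖y‖ * ‖toL2 τ (incl h x)‖)
        = ‖toL2 τ (incl h v)‖ * (‖y‖ * ‖toL2 τ (incl h x)‖) := by
      calc _ = (√‖y‖ * √‖y‖) * (‖toL2 τ (incl h v)‖ * ‖toL2 τ (incl h x)‖) := by ring
        _ = _ := by rw [Real.mul_self_sqrt (norm_nonneg _)]; ring
    rw [h3, sq] at h2
    rcases (norm_nonneg (toL2 τ (incl h v))).eq_or_lt with h4 | h4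
    · rw [← h4]; positivity
    · exact le_of_mul_le_mul_left h2 h4
  have h5 := linftyNormL2_le_of_leftBounded τ h (toL2_incl_mem τ h (y - star m * m))
    (norm_nonneg y) fun x => by rw [rmul_toL2]; exact hzx x
  rw [linftyNormL2_toL2, ofReal_norm] at h5
  exact (iInf₂_le (y - star m * m) hz).trans h5

theorem condSqNorm_add_le (hb : b ∈ (subL2 τ (F.le n))ᗮ) (hd : d ∈ subL2 τ (F.le n)) :
    condSqNorm τ F n (b + d) ≤ condSqNorm τ F n b + linftyNormL2 τ d ^ 2 := by
  rcases eq_top_or_lt_top (linftyNormL2 τ d) with htop | hfin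
  · simp [htop]
  obtain ⟨m, rfl⟩ := (linftyNormL2_lt_top_iff τ).1 hfin
  obtain ⟨m, rfl⟩ := exists_incl_of_toL2_mem τ (F.le n) hd
  rw [linftyNormL2_toL2]
  simp only [condSqNorm, linftyNormL1, ENNReal.iInf_add]
  refine le_iInf₂ fun y hy => (iInf₂_le (y + star m * m) ?_).trans ?_
  · rw [toL1_eq_condExpL1_absSq_iff] at hy ⊢
    intro x
    rw [inner_add_rmul_add τ _ hb hd, ← hy x, rmul_toL2, inner_toL2, add_mul, map_add, map_add,
      mul_assoc]
    rfl
  · refine (enorm_add_le _ _).trans (add_le_add le_rfl ?_)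
    change ‖star (m : H →L[ℂ] H) * (m : H →L[ℂ] H)‖ₑ ≤ ‖(m : H →L[ℂ] H)‖ₑ ^ 2
    rw [← ofReal_norm, ← ofReal_norm, CStarRing.norm_star_mul_self,
      ← ENNReal.ofReal_pow (norm_nonneg _), sq]

theorem subL2_mono {N₁ N₂ : VonNeumannAlgebra H} (h : N₁ ≤ N₂) (h₁ : N₁ ≤ M) (h₂ : N₂ ≤ M) :
    subL2 τ h₁ ≤ subL2 τ h₂ :=
  Submodule.topologicalClosure_mono (by rintro _ ⟨x, rfl⟩; exact ⟨incl h x, rfl⟩)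

theorem E_mem_subL2 (n : ℕ) (a : L2 τ) : E τ F n a ∈ subL2 τ (F.le n) := by
  cases n with
  | zero => exact zero_mem _
  | succ n =>
    exact subL2_mono τ (F.mono n.le_succ) _ _ (Submodule.starProjection_apply_mem _ _)

theorem diff_mem_subL2 (n : ℕ) (a : L2 τ) : diff τ F a n ∈ subL2 τ (F.le n) :=
  sub_mem (Submodule.starProjection_apply_mem _ _) (E_mem_subL2 τ F n a)

theorem sub_E_succ_mem_orthogonal (n : ℕ) (a : L2 τ) :
    a - E τ F (n + 1) a ∈ (subL2 τ (F.le n))ᗮ :=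
  Submodule.sub_starProjection_mem_orthogonal a

theorem sub_E_eq_add_diff (n : ℕ) (a : L2 τ) :
    a - E τ F n a = (a - E τ F (n + 1) a) + diff τ F a n := by
  rw [diff]; abel

theorem E_E_succ (n : ℕ) (a : L2 τ) : E τ F n (E τ F (n + 1) a) = E τ F n a := by
  cases n with
  | zero => rfl
  | succ n =>
    refine (Submodule.eq_starProjection_of_mem_orthogonal
      (Submodule.starProjection_apply_mem _ _) ?_)
    rw [← sub_sub_sub_cancel_left _ _ a]
    exact sub_mem (sub_E_succ_mem_orthogonal τ F n a) (Submodule.orthogonal_le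
      (subL2_mono τ (F.mono n.le_succ) _ _) (sub_E_succ_mem_orthogonal τ F (n + 1) a))

end Step

/-! ### Adjoints -/

section Adjoint

variable {H : Type*} [NormedAddCommGroup H] [InnerProductSpace ℂ H] [CompleteSpace H]
  {M N : VonNeumannAlgebra H} (τ : NormalTrace M) (h : N ≤ M) (F : VNFiltration M)

theorem adj_toL2 (x : M) : adj τ (toL2 τ x) = toL2 τ (star x) := by
  rw [toL2_apply, adj_coe, toL2_apply]

theorem adj_adj (a : L2 τ) : adj τ (adj τ a) = a := by
  refine (denseRange_toL2 τ).induction_on (p := fun a => adj τ (adj τ a) = a) a ?_ fun x => ?_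
  · exact isClosed_eq (by fun_prop) (by fun_prop)
  · rw [adj_toL2, adj_toL2, star_star]

theorem inner_adj_left (a b : L2 τ) : ⟪adj τ a, b⟫_ℂ = ⟪adj τ b, a⟫_ℂ := by
  refine (denseRange_toL2 τ).induction_on₂ (p := fun a b => ⟪adj τ a, b⟫_ℂ = ⟪adj τ b, a⟫_ℂ)
    ?_ (fun x y => ?_) a b
  · exact isClosed_eq (by fun_prop) (by fun_prop)
  · rw [adj_toL2, adj_toL2, inner_toL2, inner_toL2, star_star, star_star, τ.tracial]

theorem adj_mem_subL2 {b : L2 τ} (hb : b ∈ subL2 τ h) : adj τ b ∈ subL2 τ h := by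
  refine subL2_induction τ h (p := fun b => adj τ b ∈ subL2 τ h)
    ((Submodule.isClosed_topologicalClosure _).preimage (map_continuous _)) (fun y => ?_) hb
  rw [adj_toL2]
  exact toL2_incl_mem τ h (star y)

theorem condExpL2_adj (a : L2 τ) : condExpL2 τ h (adj τ a) = adj τ (condExpL2 τ h a) := by
  refine Submodule.eq_starProjection_of_mem_of_inner_eq_zero
    (adj_mem_subL2 τ h (Submodule.starProjection_apply_mem _ _)) fun w hw => ?_
  rw [← map_sub, inner_adj_left]
  exact Submodule.inner_right_of_mem_orthogonal (adj_mem_subL2 τ h hw)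
    (Submodule.sub_starProjection_mem_orthogonal a)

theorem diff_adj (a : L2 τ) (n : ℕ) : diff τ F (adj τ a) n = adj τ (diff τ F a n) := by
  have hE : ∀ n, E τ F n (adj τ a) = adj τ (E τ F n a) := fun n => by
    cases n with
    | zero => exact (map_zero (adj τ)).symm
    | succ n => exact condExpL2_adj τ _ a
  rw [diff, diff, hE, hE, map_sub]

theorem linftyNormL2_adj (a : L2 τ) : linftyNormL2 τ (adj τ a) = linftyNormL2 τ a := by
  have key : ∀ a, linftyNormL2 τ (adj τ a) ≤ linftyNormL2 τ a := fun a => by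
    refine le_iInf₂ fun y hy => (iInf₂_le (star y) ?_).trans ?_
    · rw [← hy, adj_toL2]
    · rw [← ofReal_norm, ← ofReal_norm]
      exact ENNReal.ofReal_le_ofReal (norm_star (y : H →L[ℂ] H)).le
  refine le_antisymm (key a) ?_
  simpa only [adj_adj] using key (adj τ a)

theorem normbmod_adj (a : L2 τ) : normbmod τ F (adj τ a) = normbmod τ F a := by
  simp only [normbmod, diff_adj, linftyNormL2_adj]

end Adjoint

/-! ### Comparison of the spaces and of the norms -/

section Comparison

variable {H : Type*} [NormedAddCommGroup H] [InnerProductSpace ℂ H] [CompleteSpace H]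
  {M : VonNeumannAlgebra H} (τ : NormalTrace M) (F : VNFiltration M)

theorem mem_bmod_iff {a : L2 τ} : a ∈ bmod τ F ↔ normbmod τ F a < ∞ := by
  constructor
  · rintro ⟨d, ⟨hd, -⟩, hda⟩
    simpa only [normbmod, ← hda, linftyNormL2_toL2] using hd
  · intro ha
    choose d hd using fun n => (linftyNormL2_lt_top_iff τ).1
      ((le_iSup (fun n => linftyNormL2 τ (diff τ F a n)) n).trans_lt ha)
    refine ⟨d, ⟨?_, fun n => E τ F n a, fun n => E_E_succ τ F n a, hd⟩, hd⟩
    simpa only [normbmod, ← hd, linftyNormL2_toL2] using ha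

theorem supbmo_le_supBMO (a : L2 τ) : supbmo τ F a ≤ supBMO τ F a := by
  refine iSup_mono fun n => ?_
  rw [sub_E_eq_add_diff τ F n a]
  exact condSqNorm_le_condSqNorm_add τ F (sub_E_succ_mem_orthogonal τ F n a)
    (diff_mem_subL2 τ F n a)

theorem normbmod_le_normBMOc (a : L2 τ) : normbmod τ F a ≤ normBMOc τ F a := by
  refine iSup_le fun n => ?_
  rw [normBMOc, ← ENNReal.rpow_inv_le_iff (by norm_num), one_div, inv_inv, ENNReal.rpow_ofNat]
  refine le_trans ?_ (le_iSup _ n)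
  rw [sub_E_eq_add_diff τ F n a]
  exact linftyNormL2_sq_le_condSqNorm_add τ F (sub_E_succ_mem_orthogonal τ F n a)
    (diff_mem_subL2 τ F n a)

theorem supBMO_le_supbmo_add (a : L2 τ) : supBMO τ F a ≤ supbmo τ F a + normbmod τ F a ^ 2 := by
  refine iSup_le fun n => ?_
  rw [sub_E_eq_add_diff τ F n a]
  refine (condSqNorm_add_le τ F (sub_E_succ_mem_orthogonal τ F n a)
    (diff_mem_subL2 τ F n a)).trans (add_le_add (le_iSup (fun n =>
      condSqNorm τ F n (a - E τ F (n + 1) a)) n) ?_)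
  gcongr
  exact le_iSup (fun n => linftyNormL2 τ (diff τ F a n)) n

theorem BMOc_eq : BMOc τ F = bmoc τ F ∩ bmod τ F := by
  ext a
  rw [Set.mem_inter_iff, mem_bmod_iff]
  constructor
  · intro ha
    exact ⟨(supbmo_le_supBMO τ F a).trans_lt ha, (normbmod_le_normBMOc τ F a).trans_lt
      (ENNReal.rpow_lt_top_of_nonneg (by norm_num) ha.ne)⟩
  · rintro ⟨hc, hd⟩
    exact (supBMO_le_supbmo_add τ F a).trans_lt
      (ENNReal.add_lt_top.2 ⟨hc, ENNReal.pow_lt_top hd⟩)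

theorem adj_mem_bmod_iff {a : L2 τ} : adj τ a ∈ bmod τ F ↔ a ∈ bmod τ F := by
  rw [mem_bmod_iff, mem_bmod_iff, normbmod_adj]

theorem BMOr_eq : BMOr τ F = bmor τ F ∩ bmod τ F := by
  ext a
  change adj τ a ∈ BMOc τ F ↔ adj τ a ∈ bmoc τ F ∧ a ∈ bmod τ F
  rw [BMOc_eq, Set.mem_inter_iff, adj_mem_bmod_iff]

theorem max_normbmoc_normbmod_le (a : L2 τ) :
    max (normbmoc τ F a) (normbmod τ F a) ≤ normBMOc τ F a := by
  refine max_le (max_le ?_ ?_) (normbmod_le_normBMOc τ F a)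
  · -- `E_1(a) = da_1`, because `E_0 = 0`
    have h1 : E τ F 1 a = diff τ F a 0 := (sub_zero _).symm
    rw [h1]
    exact (le_iSup (fun n => linftyNormL2 τ (diff τ F a n)) 0).trans (normbmod_le_normBMOc τ F a)
  · exact ENNReal.rpow_le_rpow (supbmo_le_supBMO τ F a) (by norm_num)

theorem normBMOc_le_sqrt_two_mul (a : L2 τ) :
    normBMOc τ F a ≤ ENNReal.ofReal √2 * max (normbmoc τ F a) (normbmod τ F a) := by
  set m := max (normbmoc τ F a) (normbmod τ F a)
  have h1 : supbmo τ F a ≤ m ^ 2 := by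
    have h2 : supbmo τ F a ^ (1 / 2 : ℝ) ≤ m := (le_max_right _ _).trans (le_max_left _ _)
    rwa [← ENNReal.le_rpow_inv_iff (by norm_num), one_div, inv_inv, ENNReal.rpow_ofNat] at h2
  have h2 : normbmod τ F a ^ 2 ≤ m ^ 2 := by
    gcongr
    exact le_max_right _ _
  have h3 : supBMO τ F a ≤ (ENNReal.ofReal √2 * m) ^ 2 := by
    rw [mul_pow, ← ENNReal.ofReal_pow (Real.sqrt_nonneg _), Real.sq_sqrt zero_le_two,
      ENNReal.ofReal_ofNat, two_mul]
    exact (supBMO_le_supbmo_add τ F a).trans (add_le_add h1 h2)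
  rw [normBMOc, ← ENNReal.le_rpow_inv_iff (by norm_num), one_div, inv_inv, ENNReal.rpow_ofNat]
  exact h3

end Comparison

end NCMart

theorem mainTheorem5 {H : Type*} [NormedAddCommGroup H] [InnerProductSpace ℂ H] [CompleteSpace H]
    (M : VonNeumannAlgebra H) (τ : NCMart.NormalTrace M) (F : NCMart.VNFiltration M) :
    -- equality of the spaces
    NCMart.BMOc τ F = NCMart.bmoc τ F ∩ NCMart.bmod τ F ∧
    NCMart.BMOr τ F = NCMart.bmor τ F ∩ NCMart.bmod τ F ∧
    NCMart.BMO τ F = NCMart.bmo τ F ∧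
    -- equivalence of the norms
    ∀ a : NCMart.L2 τ,
      (max (NCMart.normbmoc τ F a) (NCMart.normbmod τ F a) ≤ NCMart.normBMOc τ F a ∧
        NCMart.normBMOc τ F a ≤
          ENNReal.ofReal √2 * max (NCMart.normbmoc τ F a) (NCMart.normbmod τ F a)) ∧
      (max (NCMart.normbmor τ F a) (NCMart.normbmod τ F a) ≤ NCMart.normBMOr τ F a ∧
        NCMart.normBMOr τ F a ≤
          ENNReal.ofReal √2 * max (NCMart.normbmor τ F a) (NCMart.normbmod τ F a)) ∧
      (NCMart.normbmo τ F a ≤ NCMart.normBMO τ F a ∧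
        NCMart.normBMO τ F a ≤ ENNReal.ofReal √2 * NCMart.normbmo τ F a) := by
  refine ⟨NCMart.BMOc_eq τ F, NCMart.BMOr_eq τ F, ?_, fun a => ?_⟩
  · rw [NCMart.BMO, NCMart.BMOc_eq, NCMart.BMOr_eq, NCMart.bmo, ← Set.inter_inter_distrib_right]
  have hc := NCMart.max_normbmoc_normbmod_le τ F a
  have hc' := NCMart.normBMOc_le_sqrt_two_mul τ F a
  have hr := NCMart.max_normbmoc_normbmod_le τ F (NCMart.adj τ a)
  have hr' := NCMart.normBMOc_le_sqrt_two_mul τ F (NCMart.adj τ a)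
  rw [NCMart.normbmod_adj] at hr hr'
  refine ⟨⟨hc, hc'⟩, ⟨hr, hr'⟩, ?_, ?_⟩
  · exact max_le (((le_max_left _ _).trans hc).trans (le_max_left _ _))
      (hr.trans (le_max_right _ _))
  · refine max_le (hc'.trans (mul_le_mul_right ?_ _)) (hr'.trans (mul_le_mul_right ?_ _))
    · exact max_le (le_max_left _ _) ((le_max_right _ _).trans (le_max_right _ _))
    · exact le_max_right _ _
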